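/- Let $n\ge 1$. For a non-negative measurable function $\varphi$ on $\mathbb R^n$, let $$\mathcal R\varphi(t,\theta)=\int_{\langle x,\theta\rangle=t}\varphi(x)\,dx\in[0,\infty],\qquad (t,\theta)\in\mathbb R\times S^{n-1},$$ be its Radon transform (integration with respect to Lebesgue measure on the hyperplane), and for $p>0$ let $\|\varphi\|_{L^p(\mathbb R^n)}=\left(\int_{\mathbb R^n}|\varphi|^p\right)^{1/p}$. A non-negative, even, continuous function $f$ on $\mathbb R^n$ with $\int_{\mathbb R^n} f(x)(1+|x|)^{-N}dx<\infty$ for some $N$ is called an *intersection function* if, for every direction $\theta\in S^{n-1}$, $r\in\mathbb R\mapsto |r|^{n-1}\hat f(r\theta)$ is positive definite, where $\hat f$ is the Fourier transform of $f$. Here $\hat f$ and positive definiteness are understood in the sense of distributions: there are tempered distributions $T_\theta$ on $\mathbb R$, $\theta\in S^{n-1}$, each of which is positive definite (that is, $\langle \widehat{T_\theta},g\rangle\ge 0$ for every non-negative Schwartz function $g$ on $\mathbb R$), such that for every Schwartz function $\alpha$ on $\mathbb R^n$ the function $\theta\mapsto\langle T_\theta,\alpha(\cdot\,\theta)\rangle$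 is integrable on $S^{n-1}$ and $$\int_{\mathbb R^n} f\,\hat\alpha=\frac12\int_{S^{n-1}}\langle T_\theta,\alpha(\cdot\,\theta)\rangle\,d\theta .$$ (If $f$ is integrable and each function $r\mapsto|r|^{n-1}\hat f(r\theta)$ is positive definite in the pointwise sense, this holds, by integration in polar coordinates, with $T_\theta$ equal to that function.) **Theorem.** Let $p>0$ and let $\varphi,\psi\in L^1(\mathbb R^n)\cap L^p(\mathbb R^n)$ be continuous, non-negative, even functions with $$\mathcal R\varphi(t,\theta)\le\mathcal R\psi(t,\theta)\quad\text{for all }(t,\theta)\in\mathbb R\times S^{n-1}.$$ (a) If $p>1$ and $\varphi^{p-1}$ is an intersection function, then $\|\varphi\|_{L^p(\mathbb R^n)}\le\|\psi\|_{L^p(\mathbb R^n)}$. (b) If $0<p<1$ and $\psi^{p-1}$ is an intersection function, then $\|\varphi\|_{L^p(\mathbb R^n)}\le\|\psi\|_{L^p(\mathbb R^n)}$. -/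

import Mathlib

open MeasureTheory Metric
open scoped ENNReal SchwartzMap FourierTransform ComplexOrder RealInnerProductSpace

/-- The Radon transform of a non-negative function `φ` on `ℝⁿ`: the integral of `φ` over the
hyperplane `{x | ⟪x, θ⟫ = t} = t • θ + θᗮ` with respect to its `(n-1)`-dimensional Lebesgue
measure.  Since `φ` is non-negative, it is defined for all `(t, θ)` with values in `[0, ∞]`, and it
is finite exactly when `φ` is integrable over the hyperplane (for measurable `φ`). -/
noncomputable def radonTransform {n : ℕ} (φ : EuclideanSpace ℝ (Fin n) → ℝ) (t : ℝ)
    (θ : sphere (0 : EuclideanSpace ℝ (Fin n)) 1) : ℝ≥0∞ :=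
  ∫⁻ y : (ℝ ∙ (θ : EuclideanSpace ℝ (Fin n)))ᗮ,
    ENNReal.ofReal (φ (t • (θ : EuclideanSpace ℝ (Fin n)) + (y : EuclideanSpace ℝ (Fin n))))

/-- Restriction `α ↦ (r ↦ α (r • θ))` of a Schwartz function on `ℝⁿ` to the line through the origin
in the direction `θ`, parametrized by arc length. -/
noncomputable def restrictLine {n : ℕ} (θ : sphere (0 : EuclideanSpace ℝ (Fin n)) 1) :
    𝓢(EuclideanSpace ℝ (Fin n), ℂ) →L[ℂ] 𝓢(ℝ, ℂ) :=
  SchwartzMap.compCLMOfAntilipschitz ℂ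
    (LinearIsometry.toSpanSingleton ℝ (EuclideanSpace ℝ (Fin n))
      (norm_eq_of_mem_sphere θ)).toContinuousLinearMap.hasTemperateGrowth
    (LinearIsometry.toSpanSingleton ℝ (EuclideanSpace ℝ (Fin n))
      (norm_eq_of_mem_sphere θ)).antilipschitz

/-- A tempered distribution `T` on `ℝ` is positive definite if its Fourier transform is a positive
distribution.  (Real-valuedness is part of `0 ≤ z` for complex `z`.) -/
def IsPositiveDefiniteDistribution (T : 𝓢'(ℝ, ℂ)) : Prop :=
  ∀ g : 𝓢(ℝ, ℂ), (∀ t, 0 ≤ g t) → 0 ≤ (𝓕 T) g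

/-- A function `h : ℝ → ℂ` is positive definite. -/
def IsPositiveDefiniteFunction (h : ℝ → ℂ) : Prop :=
  ∀ (m : ℕ) (x : Fin m → ℝ) (c : Fin m → ℂ),
    0 ≤ ∑ l, ∑ j, c l * (starRingEnd ℂ) (c j) * h (x l - x j)

/-- The Fourier transform of the locally integrable tempered function `f` on `ℝⁿ` is, in polar
coordinates, the family `T`: for every direction `θ` the distribution `T θ` on `ℝ` is
`r ↦ |r| ^ (n - 1) * f̂ (r • θ)`.  When `f̂` is a function, integration in polar coordinates reads
`∫ f̂ α = 1/2 ∫_{S^{n-1}} ∫_ℝ |r| ^ (n - 1) f̂ (r θ) α (r θ) dr dθ`; in general `f̂` is the tempered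
distribution `α ↦ ∫ f α̂`, and the same identity is required of `T`.  The measure on the sphere is
the surface measure.  (Changing the normalization of the Fourier transform only rescales `T` and
the variable `r` by positive constants.) -/
def IsPolarFourierTransform {n : ℕ} (f : EuclideanSpace ℝ (Fin n) → ℝ)
    (T : sphere (0 : EuclideanSpace ℝ (Fin n)) 1 → 𝓢'(ℝ, ℂ)) : Prop :=
  ∀ α : 𝓢(EuclideanSpace ℝ (Fin n), ℂ),
    Integrable (fun θ => T θ (restrictLine θ α))
      (volume : Measure (EuclideanSpace ℝ (Fin n))).toSphere ∧
    ∫ x, (f x : ℂ) * (𝓕 α) x =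
      (1 / 2 : ℂ) * ∫ θ, T θ (restrictLine θ α)
        ∂(volume : Measure (EuclideanSpace ℝ (Fin n))).toSphere

/-- An intersection function on `ℝⁿ`: an even, continuous, non-negative function `f`, integrable
against some negative power of `1 + |x|` (so that it is a tempered distribution), such that for
every direction `θ` the distribution `r ↦ |r| ^ (n - 1) * f̂ (r • θ)` is positive definite. -/
structure IsIntersectionFunction {n : ℕ} (f : EuclideanSpace ℝ (Fin n) → ℝ) : Prop where
  even : Function.Even f
  continuous : Continuous f
  nonneg : ∀ x, 0 ≤ f x
  tempered : ∃ N : ℕ, Integrable (fun x => f x / (1 + ‖x‖) ^ N)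
  positiveDefinite : ∃ T : sphere (0 : EuclideanSpace ℝ (Fin n)) 1 → 𝓢'(ℝ, ℂ),
    IsPolarFourierTransform f T ∧ ∀ θ, IsPositiveDefiniteDistribution (T θ)

/-- A positive definite function that vanishes at the origin is zero. -/
theorem IsPositiveDefiniteFunction.eq_zero {h : ℝ → ℂ} (hh : IsPositiveDefiniteFunction h)
    (h0 : h 0 = 0) (r : ℝ) : h r = 0 := by
  have key : ∀ c : ℂ, 0 ≤ (starRingEnd ℂ) c * h r + c * h (-r) := by
    intro c
    have := hh 2 ![r, 0] ![1, c]
    simpa [Fin.sum_univ_two, h0] using this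
  have key2 : ∀ c : ℂ, (starRingEnd ℂ) c * h r + c * h (-r) = 0 := by
    intro c
    refine le_antisymm ?_ (key c)
    have := key (-c)
    rw [map_neg, neg_mul, neg_mul, ← neg_add] at this
    exact neg_nonneg.mp this
  have h1 := key2 1
  have h2 := key2 Complex.I
  simp only [map_one, one_mul, Complex.conj_I] at h1 h2
  have h3 : Complex.I * (h (-r) - h r) = 0 := by linear_combination h2
  have h4 : h (-r) - h r = 0 := (mul_eq_zero.mp h3).resolve_left Complex.I_ne_zero
  linear_combination (1 / 2 : ℂ) * h1 - (1 / 2 : ℂ) * h4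

/-- The definition covers the integrable functions `f` for which all the continuous functions
`r ↦ |r| ^ (n - 1) * f̂ (r • θ)` are positive definite in the pointwise sense. -/
theorem IsIntersectionFunction.of_integrable {n : ℕ} (hn : 2 ≤ n)
    {f : EuclideanSpace ℝ (Fin n) → ℝ} (he : Function.Even f) (hc : Continuous f)
    (h0 : ∀ x, 0 ≤ f x) (hi : Integrable f)
    (hpd : ∀ θ : sphere (0 : EuclideanSpace ℝ (Fin n)) 1, IsPositiveDefiniteFunction
      (fun r => ((|r| ^ (n - 1) : ℝ) : ℂ) *
        (𝓕 (fun x => (f x : ℂ))) (r • (θ : EuclideanSpace ℝ (Fin n))))) :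
    IsIntersectionFunction f := by
  have hfc : Continuous (fun x => (f x : ℂ)) := Complex.continuous_ofReal.comp hc
  have hF0 : ∀ w : EuclideanSpace ℝ (Fin n), w ≠ 0 → (𝓕 (fun x => (f x : ℂ))) w = 0 := by
    intro w hw
    have hw' : ‖w‖ ≠ 0 := norm_ne_zero_iff.mpr hw
    have hm : ‖w‖⁻¹ • w ∈ sphere (0 : EuclideanSpace ℝ (Fin n)) 1 := by
      simp [norm_smul, inv_mul_cancel₀ hw']
    have := (hpd ⟨_, hm⟩).eq_zero (by simp; left; omega) ‖w‖
    simp only [smul_smul, mul_inv_cancel₀ hw', one_smul, abs_norm] at this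
    exact (mul_eq_zero.mp this).resolve_left (by exact_mod_cast pow_ne_zero _ hw')
  have hae : 𝓕 (fun x => (f x : ℂ)) =ᵐ[volume] 0 := by
    have : Nontrivial (EuclideanSpace ℝ (Fin n)) := by
      have : Nontrivial (Fin n) := Fin.nontrivial_iff_two_le.mpr hn
      infer_instance
    filter_upwards [compl_mem_ae_iff.mpr (measure_singleton (μ := volume)
      (0 : EuclideanSpace ℝ (Fin n)))] with w hw
    exact hF0 w hw
  have hfz : ∀ x, f x = 0 := by
    have h := hfc.fourierInv_fourier_eq hi.ofReal ((integrable_congr hae).mpr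
      (integrable_zero _ _ _))
    intro x
    have hx := congrFun h x
    rw [Real.fourierInv_eq] at hx
    rw [integral_congr_ae (g := fun _ => (0 : ℂ)) (by
      filter_upwards [hae] with w hw
      simp [hw])] at hx
    simpa using hx.symm
  refine ⟨he, hc, h0, ⟨0, by simpa using hi⟩, fun _ => 0, ?_, ?_⟩
  · intro α
    simp [hfz]
  · intro θ g hg
    simp

/-! The core is a duality: if `f` is an intersection function, then `∫ f φ ≤ ∫ f ψ`
(`IsIntersectionFunction.lintegral_mul_le`). For a test function `g ≥ 0`, the polar identity with `α
= 𝓕⁻ g` writes `∫ f g` as half the integral over `θ` of `T θ` on the restriction of `𝓕⁻ g` to the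
line along `θ`. By the Fourier slice theorem this is the positive distribution `𝓕 (T θ)` applied to
`t ↦ ℛg(-t, θ)`, so `∫ f g` is monotone in the Radon transform.

Since `φ` and `ψ` need not be smooth or compactly supported, both are increasing limits of test
functions `g k`, `e j`. Then `ℛ(g k) ≤ ℛφ ≤ ℛψ = sup ℛ(e j)`, and a Dini argument on the compact
support of `ℛ(g k)` carries this through the positive distribution; monotone convergence does the
rest.

Hölder's inequality finishes. With `f = φ^(p-1)` the duality reads `∫ φ^p ≤ ∫ φ^(p-1) ψ`; with `f =
ψ^(p-1)` and `p < 1` it reads `∫ ψ^(p-1) φ ≤ ∫ ψ^p`. -/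

/-! ### Hyperplane coordinates and the Fourier slice theorem -/

/-- The coordinates `(t, y) ↦ t • θ + y` on a Euclidean space given by a unit vector `θ` preserve
the volume. -/
theorem measurePreserving_smul_add_orthogonal {E : Type*} [NormedAddCommGroup E]
    [InnerProductSpace ℝ E] [FiniteDimensional ℝ E] [MeasurableSpace E] [BorelSpace E]
    {v : E} (hv : ‖v‖ = 1) :
    MeasurePreserving (fun q : ℝ × (ℝ ∙ v)ᗮ => q.1 • v + (q.2 : E)) ∧
      MeasurableEmbedding (fun q : ℝ × (ℝ ∙ v)ᗮ => q.1 • v + (q.2 : E)) := by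
  let e : WithLp 2 (ℝ × (ℝ ∙ v)ᗮ) ≃ₗᵢ[ℝ] E :=
    (LinearIsometryEquiv.withLpProdCongr 2 (LinearIsometryEquiv.toSpanUnitSingleton v hv)
      (LinearIsometryEquiv.refl ℝ _)).trans (ℝ ∙ v).orthogonalDecomposition.symm
  have he : (fun q : ℝ × (ℝ ∙ v)ᗮ => q.1 • v + (q.2 : E)) = e ∘ WithLp.toLp 2 := by
    ext q
    simp [e]
  rw [he]
  exact ⟨e.measurePreserving.comp (WithLp.volume_preserving_toLp _ _),
    e.toHomeomorph.measurableEmbedding.comp (MeasurableEquiv.toLp 2 _).measurableEmbedding⟩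

/-- The Fourier slice theorem for compactly supported Schwartz functions. -/
theorem fourierInv_restrictLine_fourierInv_apply {n : ℕ}
    (θ : sphere (0 : EuclideanSpace ℝ (Fin n)) 1) (G : 𝓢(EuclideanSpace ℝ (Fin n), ℂ))
    (hG : HasCompactSupport G) (t : ℝ) :
    (𝓕⁻ (restrictLine θ (𝓕⁻ G))) t =
      ∫ y : (ℝ ∙ (θ : EuclideanSpace ℝ (Fin n)))ᗮ,
        G ((-t) • (θ : EuclideanSpace ℝ (Fin n)) + (y : EuclideanSpace ℝ (Fin n))) := by
  have hθ := norm_eq_of_mem_sphere θ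
  set v := (θ : EuclideanSpace ℝ (Fin n))
  obtain ⟨hM, hME⟩ := measurePreserving_smul_add_orthogonal hθ
  have horth : ∀ (s : ℝ) (y : (ℝ ∙ v)ᗮ), ⟪s • v, (y : EuclideanSpace ℝ (Fin n))⟫ = 0 :=
    fun s y => Submodule.inner_right_of_mem_orthogonal
      (Submodule.smul_mem _ _ (Submodule.mem_span_singleton_self v)) y.2
  set K : ℝ → ℂ := fun s => ∫ y : (ℝ ∙ v)ᗮ, G (s • v + (y : EuclideanSpace ℝ (Fin n))) with hK
  -- Continuity makes the inversion below hold at every `t`, not just almost everywhere. By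
  -- Pythagoras `‖y‖ ≤ ‖s • v + y‖`, so one ball contains the `y`-supports for all `s`.
  have hKc : Continuous K := by
    obtain ⟨R, hR⟩ := hG.isCompact.isBounded.subset_closedBall 0
    rw [← continuousOn_univ]
    refine continuousOn_integral_of_compact_support (isCompact_closedBall (0 : (ℝ ∙ v)ᗮ) R) ?_ ?_
    · have := G.continuous
      exact Continuous.continuousOn (by unfold Function.uncurry; fun_prop)
    · intro s y _ hy
      refine image_eq_zero_of_notMem_tsupport fun hmem => hy ?_
      have h1 := hR hmem
      rw [mem_closedBall_zero_iff] at h1 ⊢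
      refine le_trans ?_ h1
      have h2 := norm_add_sq_eq_norm_sq_add_norm_sq_of_inner_eq_zero _ _ (horth s y)
      rw [Submodule.coe_norm]
      nlinarith [norm_nonneg (s • v + (y : EuclideanSpace ℝ (Fin n))),
        norm_nonneg (y : EuclideanSpace ℝ (Fin n)), mul_self_nonneg ‖s • v‖]
  have hprod : Integrable (fun q : ℝ × (ℝ ∙ v)ᗮ =>
      G (q.1 • v + (q.2 : EuclideanSpace ℝ (Fin n)))) (volume.prod volume) :=
    (hM.integrable_comp_emb hME).mpr (G.integrable (μ := volume))
  have hKi : Integrable K := hprod.integral_prod_left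
  -- The kernels of `𝓕` and `𝓕⁻` have opposite signs; the reflection of `K` matches them.
  have hF : 𝓕 (fun s => K (-s)) = restrictLine θ (𝓕⁻ G) := by
    ext r
    have h1 : (restrictLine θ (𝓕⁻ G)) r = (𝓕⁻ (G : EuclideanSpace ℝ (Fin n) → ℂ)) (r • v) := by
      rw [← SchwartzMap.fourierInv_coe]
      rfl
    have h2 : ∀ q : ℝ × (ℝ ∙ v)ᗮ,
        ⟪q.1 • v + (q.2 : EuclideanSpace ℝ (Fin n)), r • v⟫ = q.1 * r := by
      intro q
      rw [inner_add_left, real_inner_comm (r • v) (q.2 : EuclideanSpace ℝ (Fin n)), horth,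
        real_inner_smul_left, real_inner_smul_right, real_inner_self_eq_norm_sq, hθ]
      ring
    rw [h1, Real.fourierInv_eq, Real.fourier_real_eq, ← hM.integral_comp hME]
    simp only [h2]
    rw [← integral_neg_eq_self, Measure.volume_eq_prod, integral_prod]
    · refine integral_congr_ae (.of_forall fun s => ?_)
      simp only [neg_mul, neg_neg, hK]
      simp only [Circle.smul_def]
      rw [integral_smul]
    · refine (hprod.norm).mono' ?_ (.of_forall fun q => ?_)
      · exact (Continuous.aestronglyMeasurable (by fun_prop)).smul hprod.aestronglyMeasurable
      · simp
  have hinv := (hKc.comp continuous_neg).fourierInv_fourier_eq hKi.comp_neg (by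
    change Integrable (𝓕 (fun s => K (-s)))
    rw [hF]
    exact (restrictLine θ (𝓕⁻ G)).integrable)
  rw [SchwartzMap.fourierInv_coe, ← hF]
  exact congrFun hinv t

/-! ### Smooth approximation from below and a Dini argument -/

open Filter Topology in
open scoped Manifold ContDiff in
/-- A continuous non-negative function is the pointwise limit of an increasing sequence of
non-negative smooth functions with compact support. -/
theorem exists_monotone_smooth_tendsto {E : Type*} [NormedAddCommGroup E] [NormedSpace ℝ E]
    [FiniteDimensional ℝ E] {u : E → ℝ} (hu : Continuous u) (hu0 : ∀ x, 0 ≤ u x) :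
    ∃ g : ℕ → E → ℝ, (∀ j, ContDiff ℝ ∞ (g j)) ∧ (∀ j, HasCompactSupport (g j)) ∧
      (∀ j x, 0 ≤ g j x) ∧ Monotone g ∧ ∀ x, Tendsto (fun j => g j x) atTop (𝓝 (u x)) := by
  -- The subtracted term makes `a j` strictly increasing in `j`, leaving room for a smooth function
  -- between consecutive positive parts, and negative for large `‖x‖`, giving compact support.
  let a : ℕ → E → ℝ := fun j x => min (u x) j - (1 + ‖x‖) / (j + 1)
  have hac : ∀ j, Continuous (a j) := fun j => by fun_prop
  have halt : ∀ j x, a j x < a (j + 1) x := by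
    intro j x
    have h1 : min (u x) (j : ℝ) ≤ min (u x) ((j + 1 : ℕ) : ℝ) :=
      min_le_min le_rfl (by push_cast; linarith)
    have h2 : (1 + ‖x‖) / (((j + 1 : ℕ) : ℝ) + 1) < (1 + ‖x‖) / ((j : ℝ) + 1) := by
      have := norm_nonneg x
      apply div_lt_div_of_pos_left <;> first | positivity | (push_cast; linarith)
    simp only [a]
    linarith
  have key : ∀ j, ∃ g : C^∞⟮𝓘(ℝ, E), E; 𝓘(ℝ, ℝ), ℝ⟯,
      ∀ x, g x ∈ Set.Icc (max (a j x) 0) (max (a (j + 1) x) 0) := by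
    intro j
    -- Smooth partitions of unity reduce the choice to local constants: `0` where `a (j + 1) x ≤ 0`,
    -- since `a j < 0` nearby, and otherwise a value strictly between the bounds at `x`.
    refine exists_contMDiffMap_forall_mem_convex_of_local_const 𝓘(ℝ, E)
      (fun x => convex_Icc _ _) fun x => ?_
    rcases le_or_gt (a (j + 1) x) 0 with hx | hx
    · refine ⟨0, ?_⟩
      filter_upwards [(hac j).continuousAt.eventually_lt continuousAt_const
        ((halt j x).trans_le hx)] with y hy
      exact ⟨(max_eq_right hy.le).le, le_max_right _ _⟩
    · obtain ⟨c, hc1, hc2⟩ := exists_between (max_lt (halt j x) hx)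
      refine ⟨c, ?_⟩
      filter_upwards [((hac j).max continuous_const).continuousAt.eventually_lt
        continuousAt_const hc1, continuousAt_const.eventually_lt (hac (j + 1)).continuousAt hc2]
        with y hy1 hy2
      exact ⟨hy1.le, hy2.le.trans (le_max_left _ _)⟩
  choose g hg using key
  have hlim : ∀ x, Tendsto (fun j => max (a j x) 0) atTop (𝓝 (u x)) := by
    intro x
    have h1 : Tendsto (fun j : ℕ => min (u x) (j : ℝ)) atTop (𝓝 (u x)) := by
      refine tendsto_const_nhds.congr' ?_
      filter_upwards [tendsto_natCast_atTop_atTop.eventually_ge_atTop (u x)] with j hj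
      exact (min_eq_left hj).symm
    have h2 : Tendsto (fun j : ℕ => (1 + ‖x‖) / ((j : ℝ) + 1)) atTop (𝓝 0) :=
      tendsto_const_nhds.div_atTop
        (tendsto_atTop_add_const_right _ _ tendsto_natCast_atTop_atTop)
    have h3 := (h1.sub h2).max (tendsto_const_nhds (x := (0 : ℝ)))
    rwa [sub_zero, max_eq_left (hu0 x)] at h3
  refine ⟨fun j => g j, fun j => (g j).contMDiff.contDiff, fun j => ?_,
    fun j x => (le_max_right _ _).trans (hg j x).1,
    monotone_nat_of_le_succ fun j x => (hg j x).2.trans (hg (j + 1) x).1,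
    fun x => tendsto_of_tendsto_of_tendsto_of_le_of_le (hlim x)
      ((hlim x).comp (tendsto_add_atTop_nat 1)) (fun j => (hg j x).1) fun j => (hg j x).2⟩
  -- Beyond this radius `(1 + ‖x‖) / (j + 2)` exceeds `j + 1 ≥ min (u x) (j + 1)`, so `a (j + 1) x <
  -- 0`.
  refine HasCompactSupport.of_support_subset_isCompact
    (isCompact_closedBall (0 : E) (((j : ℝ) + 1) * (j + 2))) fun x hx => ?_
  rw [mem_closedBall_zero_iff]
  by_contra! hlt
  refine hx (le_antisymm ((hg j x).2.trans (max_le ?_ le_rfl)) ((le_max_right _ _).trans (hg j x).1))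
  have h1 : min (u x) ((j + 1 : ℕ) : ℝ) ≤ (j : ℝ) + 1 := by
    push_cast
    exact min_le_right _ _
  have h2 : (j : ℝ) + 1 ≤ (1 + ‖x‖) / (((j + 1 : ℕ) : ℝ) + 1) := by
    rw [le_div_iff₀ (by positivity)]
    push_cast
    nlinarith
  simp only [a]
  linarith

open Filter in
/-- The lower semicontinuity of a positive functional on Schwartz functions along an increasing
sequence whose supremum dominates a compactly supported function. -/
theorem ofReal_re_le_iSup_of_nonneg {W : 𝓢'(ℝ, ℂ)}
    (hW : ∀ g : 𝓢(ℝ, ℂ), (∀ t, 0 ≤ g t) → 0 ≤ W g)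
    {h : 𝓢(ℝ, ℂ)} {k : ℝ → ℝ} (hk : ∀ t, h t = k t) (hc : HasCompactSupport h)
    {H : ℕ → 𝓢(ℝ, ℂ)} {κ : ℕ → ℝ → ℝ} (hκ : ∀ j t, H j t = κ j t) (hκ0 : ∀ j t, 0 ≤ κ j t)
    (hmono : Monotone κ) (hsup : ∀ t, ENNReal.ofReal (k t) ≤ ⨆ j, ENNReal.ofReal (κ j t)) :
    ENNReal.ofReal (W h).re ≤ ⨆ j, ENNReal.ofReal (W (H j)).re := by
  obtain ⟨R, hR⟩ := hc.isCompact.isBounded.subset_closedBall 0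
  let b : ContDiffBump (0 : ℝ) := ⟨|R| + 1, |R| + 2, by positivity, by linarith⟩
  let χ : 𝓢(ℝ, ℂ) := HasCompactSupport.toSchwartzMap (f := fun t => ((b t : ℝ) : ℂ))
    (b.hasCompactSupport.comp_left Complex.ofReal_zero)
    (Complex.ofRealCLM.contDiff.comp b.contDiff)
  have hχ : ∀ t, χ t = ((b t : ℝ) : ℂ) := fun _ => rfl
  have hkc : Continuous k := by
    have : k = fun t => (h t).re := by ext t; simp [hk]
    rw [this]
    exact Complex.continuous_re.comp h.continuous
  have hκc : ∀ j, Continuous (κ j) := by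
    intro j
    have : κ j = fun t => (H j t).re := by ext t; simp [hκ]
    rw [this]
    exact Complex.continuous_re.comp (H j).continuous
  have hpt : ∀ ε > 0, ∀ t, ∃ j, k t < κ j t + ε := by
    intro ε hε t
    by_contra! hcon
    have hpos : 0 < k t := by linarith [hcon 0, hκ0 0 t]
    refine absurd ((hsup t).trans (iSup_le fun j =>
      ENNReal.ofReal_le_ofReal (le_sub_iff_add_le.mpr (hcon j)))) (not_le.mpr ?_)
    rw [ENNReal.ofReal_lt_ofReal_iff hpos]
    linarith
  -- Dini: the sets `{k < κ j + ε}` are open, increase with `j` and cover the compact support.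
  have hunif : ∀ ε > 0, ∃ j, ∀ t ∈ tsupport h, k t < κ j t + ε := by
    intro ε hε
    obtain ⟨j, hj⟩ := hc.isCompact.elim_directed_cover (fun j => {t | k t < κ j t + ε})
      (fun j => isOpen_lt hkc ((hκc j).add continuous_const))
      (fun t _ => Set.mem_iUnion.mpr (hpt ε hε t))
      (directed_of_isDirected_le fun i j hij t ht =>
        lt_of_lt_of_le ht (add_le_add_left (hmono hij t) ε))
    exact ⟨j, hj⟩
  have hbd : ∀ ε > 0, ∃ j, (W h).re ≤ (W (H j)).re + ε * (W χ).re := by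
    intro ε hε
    obtain ⟨j, hj⟩ := hunif ε hε
    refine ⟨j, ?_⟩
    -- On the support of `h` the bump `χ` is `1` and absorbs the error `ε`; off it `h` vanishes and
    -- the other terms are non-negative.
    have h0 : 0 ≤ W (H j + (ε : ℂ) • χ - h) := by
      refine hW _ fun t => ?_
      have : (H j + (ε : ℂ) • χ - h) t = ((κ j t + ε * b t - k t : ℝ) : ℂ) := by
        simp [hk, hκ, hχ]
      rw [this, Complex.zero_le_real]
      by_cases ht : t ∈ tsupport h
      · have h1 : b t = 1 := b.one_of_mem_closedBall
          (closedBall_subset_closedBall (by change R ≤ |R| + 1; linarith [le_abs_self R]) (hR ht))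
        rw [h1]
        linarith [hj t ht]
      · have h1 : k t = 0 := by
          exact_mod_cast (hk t).symm.trans (image_eq_zero_of_notMem_tsupport ht)
        rw [h1]
        have := mul_nonneg hε.le (b.nonneg (x := t))
        linarith [hκ0 j t]
    have h1 := (Complex.nonneg_iff.mp h0).1
    simp only [map_sub, map_add, map_smul, Complex.sub_re, Complex.add_re, smul_eq_mul,
      Complex.re_ofReal_mul] at h1
    linarith
  have hχ0 : 0 ≤ (W χ).re := (Complex.nonneg_iff.mp
    (hW χ fun t => by rw [hχ, Complex.zero_le_real]; exact b.nonneg)).1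
  refine ENNReal.le_of_forall_pos_le_add fun δ hδ _ => ?_
  have hδ' : (0 : ℝ) < δ := hδ
  obtain ⟨j, hj⟩ := hbd (δ / ((W χ).re + 1)) (by positivity)
  have h2 : (δ : ℝ) / ((W χ).re + 1) * (W χ).re ≤ δ := by
    rw [div_mul_eq_mul_div, div_le_iff₀ (by positivity)]
    nlinarith
  calc ENNReal.ofReal (W h).re ≤ ENNReal.ofReal ((W (H j)).re + δ) :=
        ENNReal.ofReal_le_ofReal (by linarith)
    _ ≤ ENNReal.ofReal (W (H j)).re + ENNReal.ofReal δ := ENNReal.ofReal_add_le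
    _ ≤ _ := by
      rw [ENNReal.ofReal_coe_nnreal]
      gcongr
      exact le_iSup (fun j => ENNReal.ofReal (W (H j)).re) j

theorem ofReal_eq_iSup_of_monotone_tendsto {X : Type*} {g : ℕ → X → ℝ} {u : X → ℝ}
    (hmono : Monotone g) (hlim : ∀ x, Filter.Tendsto (fun j => g j x) Filter.atTop (nhds (u x)))
    (x : X) : ENNReal.ofReal (u x) = ⨆ j, ENNReal.ofReal (g j x) :=
  (iSup_eq_of_tendsto (fun _ _ hij => ENNReal.ofReal_le_ofReal (hmono hij x))
    (ENNReal.tendsto_ofReal (hlim x))).symm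

/-! ### Radon transforms of test functions and the duality inequality -/

section Approximants

variable {n : ℕ}

theorem integrable_hyperplane (θ : sphere (0 : EuclideanSpace ℝ (Fin n)) 1)
    {g : EuclideanSpace ℝ (Fin n) → ℝ} (hg : Continuous g) (hgc : HasCompactSupport g) (t : ℝ) :
    Integrable fun y : (ℝ ∙ (θ : EuclideanSpace ℝ (Fin n)))ᗮ =>
      g (t • (θ : EuclideanSpace ℝ (Fin n)) + (y : EuclideanSpace ℝ (Fin n))) := by
  refine Continuous.integrable_of_hasCompactSupport (by fun_prop) ?_
  exact hgc.comp_isClosedEmbedding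
    ((Homeomorph.addLeft (t • (θ : EuclideanSpace ℝ (Fin n)))).isClosedEmbedding.comp
      (Submodule.closed_of_finiteDimensional _).isClosedEmbedding_subtypeVal)

theorem radonTransform_ne_top (θ : sphere (0 : EuclideanSpace ℝ (Fin n)) 1)
    {g : EuclideanSpace ℝ (Fin n) → ℝ} (hg : Continuous g) (hgc : HasCompactSupport g) (t : ℝ) :
    radonTransform g t θ ≠ ∞ :=
  (integrable_hyperplane θ hg hgc t).lintegral_lt_top.ne

theorem radonTransform_mono {g h : EuclideanSpace ℝ (Fin n) → ℝ} (hgh : ∀ x, g x ≤ h x) (t : ℝ)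
    (θ : sphere (0 : EuclideanSpace ℝ (Fin n)) 1) :
    radonTransform g t θ ≤ radonTransform h t θ :=
  lintegral_mono fun _ => ENNReal.ofReal_le_ofReal (hgh _)

theorem radonTransform_eq_iSup {g : ℕ → EuclideanSpace ℝ (Fin n) → ℝ}
    {u : EuclideanSpace ℝ (Fin n) → ℝ} (hg : ∀ j, Continuous (g j)) (hmono : Monotone g)
    (hlim : ∀ x, Filter.Tendsto (fun j => g j x) Filter.atTop (nhds (u x))) (t : ℝ)
    (θ : sphere (0 : EuclideanSpace ℝ (Fin n)) 1) :
    radonTransform u t θ = ⨆ j, radonTransform (g j) t θ := by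
  unfold radonTransform
  simp_rw [ofReal_eq_iSup_of_monotone_tendsto hmono hlim]
  refine lintegral_iSup (fun j => ?_) fun i j hij y => ENNReal.ofReal_le_ofReal (hmono hij _)
  have := hg j
  exact ENNReal.measurable_ofReal.comp (Continuous.measurable (by fun_prop))

/-- A real-valued smooth function with compact support, as a complex Schwartz function. -/
noncomputable def schwartzOfReal (g : EuclideanSpace ℝ (Fin n) → ℝ) (hg : ContDiff ℝ (⊤ : ℕ∞) g)
    (hgc : HasCompactSupport g) : 𝓢(EuclideanSpace ℝ (Fin n), ℂ) :=
  HasCompactSupport.toSchwartzMap (f := fun x => (g x : ℂ)) (hgc.comp_left Complex.ofReal_zero)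
    (Complex.ofRealCLM.contDiff.comp hg)

@[simp]
theorem schwartzOfReal_apply {g : EuclideanSpace ℝ (Fin n) → ℝ} (hg : ContDiff ℝ (⊤ : ℕ∞) g)
    (hgc : HasCompactSupport g) (x : EuclideanSpace ℝ (Fin n)) :
    schwartzOfReal g hg hgc x = (g x : ℂ) := rfl

/-- The Radon transform of a test function, computed by the Fourier slice theorem. -/
theorem fourierInv_restrictLine_schwartzOfReal {g : EuclideanSpace ℝ (Fin n) → ℝ}
    (hg : ContDiff ℝ (⊤ : ℕ∞) g) (hgc : HasCompactSupport g) (hg0 : ∀ x, 0 ≤ g x)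
    (θ : sphere (0 : EuclideanSpace ℝ (Fin n)) 1) (t : ℝ) :
    (𝓕⁻ (restrictLine θ (𝓕⁻ (schwartzOfReal g hg hgc)))) t =
      ((radonTransform g (-t) θ).toReal : ℂ) := by
  have hc : HasCompactSupport (schwartzOfReal g hg hgc) :=
    hgc.mono fun x hx => by simpa using hx
  rw [fourierInv_restrictLine_fourierInv_apply θ _ hc,
    radonTransform, ← ofReal_integral_eq_lintegral_ofReal
    (integrable_hyperplane θ hg.continuous hgc _) (.of_forall fun _ => hg0 _),
    ENNReal.toReal_ofReal (integral_nonneg fun _ => hg0 _)]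
  simp only [schwartzOfReal_apply]
  exact integral_ofReal

/-- A hyperplane at distance `|t| > R` from the origin misses the ball of radius `R`. This supplies
the compactness for the Dini argument. -/
theorem hasCompactSupport_radonTransform {g : EuclideanSpace ℝ (Fin n) → ℝ}
    (hgc : HasCompactSupport g) (θ : sphere (0 : EuclideanSpace ℝ (Fin n)) 1) :
    HasCompactSupport fun t => radonTransform g t θ := by
  obtain ⟨R, hR⟩ := hgc.isCompact.isBounded.subset_closedBall 0
  refine HasCompactSupport.intro (isCompact_closedBall (0 : ℝ) R) fun t ht => ?_
  refine (lintegral_congr fun y => ?_).trans lintegral_zero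
  rw [image_eq_zero_of_notMem_tsupport (f := g) fun hmem => ht ?_, ENNReal.ofReal_zero]
  have h1 := hR hmem
  rw [mem_closedBall_zero_iff] at h1 ⊢
  refine le_trans ?_ h1
  have horth : ⟪t • (θ : EuclideanSpace ℝ (Fin n)), (y : EuclideanSpace ℝ (Fin n))⟫ = 0 :=
    Submodule.inner_right_of_mem_orthogonal
      (Submodule.smul_mem _ _ (Submodule.mem_span_singleton_self _)) y.2
  have h2 := norm_add_sq_eq_norm_sq_add_norm_sq_of_inner_eq_zero _ _ horth
  have h3 : ‖t • (θ : EuclideanSpace ℝ (Fin n))‖ = ‖t‖ := by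
    rw [norm_smul, norm_eq_of_mem_sphere, mul_one]
  rw [h3] at h2
  exact abs_le_of_sq_le_sq' (by
    nlinarith [mul_self_nonneg ‖(y : EuclideanSpace ℝ (Fin n))‖]) (norm_nonneg _) |>.2

/-- Pairing a test function with a function whose Fourier transform is a family of positive
definite distributions on lines. -/
theorem lintegral_ofReal_mul_eq_of_isPolarFourierTransform {f : EuclideanSpace ℝ (Fin n) → ℝ}
    (hf : Continuous f) (hf0 : ∀ x, 0 ≤ f x)
    {T : sphere (0 : EuclideanSpace ℝ (Fin n)) 1 → 𝓢'(ℝ, ℂ)} (hT : IsPolarFourierTransform f T)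
    (hpd : ∀ θ, IsPositiveDefiniteDistribution (T θ))
    {g : EuclideanSpace ℝ (Fin n) → ℝ} (hg : ContDiff ℝ (⊤ : ℕ∞) g) (hgc : HasCompactSupport g)
    (hg0 : ∀ x, 0 ≤ g x) :
    ∫⁻ x, ENNReal.ofReal (f x * g x) = 2⁻¹ * ∫⁻ θ, ENNReal.ofReal
      ((𝓕 (T θ)) (𝓕⁻ (restrictLine θ (𝓕⁻ (schwartzOfReal g hg hgc))))).re
        ∂(volume : Measure (EuclideanSpace ℝ (Fin n))).toSphere := by
  obtain ⟨hint, heq⟩ := hT (𝓕⁻ (schwartzOfReal g hg hgc))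
  rw [FourierTransform.fourier_fourierInv_eq] at heq
  simp only [TemperedDistribution.fourier_apply, FourierTransform.fourier_fourierInv_eq]
  -- The positive distribution `𝓕 (T θ)` is tested on `ℛg(-t, θ) ≥ 0`. This sign lets the Bochner
  -- integral over the sphere become a lower Lebesgue integral.
  have hpos : ∀ θ, 0 ≤ (T θ (restrictLine θ (𝓕⁻ (schwartzOfReal g hg hgc)))).re := by
    intro θ
    have h := hpd θ (𝓕⁻ (restrictLine θ (𝓕⁻ (schwartzOfReal g hg hgc)))) fun t => by
      rw [fourierInv_restrictLine_schwartzOfReal hg hgc hg0, Complex.zero_le_real]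
      exact ENNReal.toReal_nonneg
    rw [TemperedDistribution.fourier_apply, FourierTransform.fourier_fourierInv_eq] at h
    exact (Complex.nonneg_iff.mp h).1
  have hA := ofReal_integral_eq_lintegral_ofReal hint.re (.of_forall hpos)
  simp only [RCLike.re_eq_complex_re] at hA
  rw [← hA,
    ← ofReal_integral_eq_lintegral_ofReal (f := fun x => f x * g x)
      ((hf.mul hg.continuous).integrable_of_hasCompactSupport hgc.mul_left)
      (.of_forall fun x => mul_nonneg (hf0 x) (hg0 x))]
  have hre := congrArg Complex.re heq
  have h1 : ∫ x, (f x : ℂ) * schwartzOfReal g hg hgc x = ((∫ x, f x * g x : ℝ) : ℂ) := by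
    simp only [schwartzOfReal_apply, ← Complex.ofReal_mul]
    exact integral_ofReal
  have h2 : (1 / 2 : ℂ) = ((2⁻¹ : ℝ) : ℂ) := by norm_num
  rw [h1, Complex.ofReal_re, h2, Complex.re_ofReal_mul] at hre
  have h3 := integral_re hint
  simp only [RCLike.re_eq_complex_re] at h3 ⊢
  rw [hre, h3, ENNReal.ofReal_mul (by norm_num), ENNReal.ofReal_inv_of_pos two_pos,
    ENNReal.ofReal_ofNat]

/-- Integration against an intersection function is monotone with respect to the Radon
transform. -/
theorem IsIntersectionFunction.lintegral_mul_le {f : EuclideanSpace ℝ (Fin n) → ℝ}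
    (hf : IsIntersectionFunction f) {φ ψ : EuclideanSpace ℝ (Fin n) → ℝ}
    (hφc : Continuous φ) (hψc : Continuous ψ) (hφ0 : ∀ x, 0 ≤ φ x) (hψ0 : ∀ x, 0 ≤ ψ x)
    (hR : ∀ t θ, radonTransform φ t θ ≤ radonTransform ψ t θ) :
    ∫⁻ x, ENNReal.ofReal (f x * φ x) ≤ ∫⁻ x, ENNReal.ofReal (f x * ψ x) := by
  obtain ⟨T, hT, hpd⟩ := hf.positiveDefinite
  obtain ⟨g, hgs, hgc, hg0, hgm, hgl⟩ := exists_monotone_smooth_tendsto hφc hφ0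
  obtain ⟨e, hes, hec, he0, hem, hel⟩ := exists_monotone_smooth_tendsto hψc hψ0
  have hfc := hf.continuous
  have hfg : Monotone fun j x => f x * g j x :=
    fun i j hij x => mul_le_mul_of_nonneg_left (hgm hij x) (hf.nonneg x)
  have hsup : ∫⁻ x, ENNReal.ofReal (f x * φ x) = ⨆ k, ∫⁻ x, ENNReal.ofReal (f x * g k x) := by
    simp_rw [ofReal_eq_iSup_of_monotone_tendsto (u := fun x => f x * φ x) hfg
      fun x => (hgl x).const_mul (f x)]
    refine lintegral_iSup (fun j => ?_) fun i j hij x => ENNReal.ofReal_le_ofReal (hfg hij x)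
    have := (hgs j).continuous
    exact ENNReal.measurable_ofReal.comp (Continuous.measurable (by fun_prop))
  rw [hsup]
  refine iSup_le fun k => ?_
  rw [lintegral_ofReal_mul_eq_of_isPolarFourierTransform hfc hf.nonneg hT hpd (hgs k) (hgc k)
    (hg0 k)]
  let A : ℕ → sphere (0 : EuclideanSpace ℝ (Fin n)) 1 → ℝ≥0∞ := fun j θ => ENNReal.ofReal
    ((𝓕 (T θ)) (𝓕⁻ (restrictLine θ (𝓕⁻ (schwartzOfReal (e j) (hes j) (hec j)))))).re
  have hAmono : Monotone A := by
    intro i j hij θ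
    refine ENNReal.ofReal_le_ofReal ?_
    have h := hpd θ (𝓕⁻ (restrictLine θ (𝓕⁻ (schwartzOfReal (e j) (hes j) (hec j)))) -
      𝓕⁻ (restrictLine θ (𝓕⁻ (schwartzOfReal (e i) (hes i) (hec i))))) fun t => by
        rw [sub_apply, fourierInv_restrictLine_schwartzOfReal _ _ (he0 j),
          fourierInv_restrictLine_schwartzOfReal _ _ (he0 i), ← Complex.ofReal_sub,
          Complex.zero_le_real, sub_nonneg]
        exact ENNReal.toReal_mono (radonTransform_ne_top θ (hes j).continuous (hec j) _)
          (radonTransform_mono (hem hij) _ _)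
    rw [map_sub] at h
    have := (Complex.nonneg_iff.mp h).1
    rw [Complex.sub_re] at this
    linarith
  have hpt : ∀ θ, ENNReal.ofReal
      ((𝓕 (T θ)) (𝓕⁻ (restrictLine θ (𝓕⁻ (schwartzOfReal (g k) (hgs k) (hgc k)))))).re ≤
        ⨆ j, A j θ := by
    intro θ
    refine ofReal_re_le_iSup_of_nonneg (hpd θ)
      (k := fun t => (radonTransform (g k) (-t) θ).toReal)
      (κ := fun j t => (radonTransform (e j) (-t) θ).toReal)
      (fourierInv_restrictLine_schwartzOfReal _ _ (hg0 k) θ) ?_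
      (fun j => fourierInv_restrictLine_schwartzOfReal _ _ (he0 j) θ)
      (fun _ _ => ENNReal.toReal_nonneg) ?_ ?_
    · have hc := ((hasCompactSupport_radonTransform (hgc k) θ).comp_homeomorph
        (Homeomorph.neg ℝ))
      refine hc.mono fun t ht => ?_
      rw [Function.mem_support, fourierInv_restrictLine_schwartzOfReal _ _ (hg0 k)] at ht
      intro h0
      refine ht ?_
      have h1 : radonTransform (g k) (-t) θ = 0 := h0
      simp [h1]
    · exact fun i j hij t => ENNReal.toReal_mono
        (radonTransform_ne_top θ (hes j).continuous (hec j) _) (radonTransform_mono (hem hij) _ _)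
    · intro t
      simp only [ENNReal.ofReal_toReal (radonTransform_ne_top θ (hgs k).continuous (hgc k) _),
        ENNReal.ofReal_toReal (radonTransform_ne_top θ (hes _).continuous (hec _) _)]
      rw [← radonTransform_eq_iSup (fun j => (hes j).continuous) hem hel]
      exact (radonTransform_mono (fun x => Monotone.ge_of_tendsto (f := fun k => g k x)
        (fun i j hij => hgm hij x) (hgl x) k) _ _).trans (hR _ _)
  calc _ ≤ 2⁻¹ * ∫⁻ θ, ⨆ j, A j θ ∂(volume : Measure (EuclideanSpace ℝ (Fin n))).toSphere := by
        gcongr with θ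
        exact hpt θ
    _ = ⨆ j, ∫⁻ x, ENNReal.ofReal (f x * e j x) := by
        -- The polar identity gives only a.e. measurability in `θ`, hence the primed form of
        -- monotone convergence.
        rw [lintegral_iSup' (fun j => ?_) (.of_forall fun θ i j hij => hAmono hij θ),
          ENNReal.mul_iSup]
        · simp_rw [lintegral_ofReal_mul_eq_of_isPolarFourierTransform hfc hf.nonneg hT hpd
            (hes _) (hec _) (he0 _)]
        · have h := (hT (𝓕⁻ (schwartzOfReal (e j) (hes j) (hec j)))).1.re.aemeasurable
          simp only [TemperedDistribution.fourier_apply,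
            FourierTransform.fourier_fourierInv_eq]
          exact h.ennreal_ofReal
    _ ≤ _ := by
        refine iSup_le fun j => lintegral_mono fun x => ENNReal.ofReal_le_ofReal ?_
        exact mul_le_mul_of_nonneg_left
          (Monotone.ge_of_tendsto (f := fun j => e j x) (fun i j hij => hem hij x) (hel x) j)
          (hf.nonneg x)

end Approximants

/-! ### Hölder's inequality on either side of `p = 1` -/

theorem eLpNorm_ofReal_eq_lintegral_ofReal_rpow {α : Type*} [MeasurableSpace α] {μ : Measure α}
    {p : ℝ} (hp : 0 < p) {u : α → ℝ} (hu : ∀ x, 0 ≤ u x) :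
    eLpNorm u (ENNReal.ofReal p) μ = (∫⁻ x, ENNReal.ofReal (u x ^ p) ∂μ) ^ (1 / p) := by
  rw [eLpNorm_eq_lintegral_rpow_enorm_toReal (by simpa using hp) ENNReal.ofReal_ne_top,
    ENNReal.toReal_ofReal hp.le]
  simp only [Real.enorm_of_nonneg (hu _), ENNReal.ofReal_rpow_of_nonneg (hu _) hp.le]

theorem lintegral_ofReal_rpow_ne_top {α : Type*} [MeasurableSpace α] {μ : Measure α}
    {p : ℝ} (hp : 0 < p) {u : α → ℝ} (hu : ∀ x, 0 ≤ u x) (h : MemLp u (ENNReal.ofReal p) μ) :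
    ∫⁻ x, ENNReal.ofReal (u x ^ p) ∂μ ≠ ∞ := by
  have h1 := h.eLpNorm_lt_top
  rw [eLpNorm_ofReal_eq_lintegral_ofReal_rpow hp hu] at h1
  intro htop
  rw [htop, ENNReal.top_rpow_of_pos (by positivity)] at h1
  exact h1.ne rfl

/-- Hölder's inequality, in the form in which it compares two `Lᵖ` norms for `1 < p`. -/
theorem lintegral_rpow_le_of_one_lt {α : Type*} [MeasurableSpace α] {μ : Measure α} {p : ℝ}
    (hp : 1 < p) {u v : α → ℝ} (hum : Measurable u) (hvm : Measurable v) (hu : ∀ x, 0 ≤ u x)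
    (hv : ∀ x, 0 ≤ v x) (hfin : ∫⁻ x, ENNReal.ofReal (u x ^ p) ∂μ ≠ ∞)
    (h : ∫⁻ x, ENNReal.ofReal (u x ^ (p - 1) * u x) ∂μ ≤
      ∫⁻ x, ENNReal.ofReal (u x ^ (p - 1) * v x) ∂μ) :
    ∫⁻ x, ENNReal.ofReal (u x ^ p) ∂μ ≤ ∫⁻ x, ENNReal.ofReal (v x ^ p) ∂μ := by
  have hp0 : 0 < p := by linarith
  have hpq : p.HolderConjugate (p / (p - 1)) := Real.HolderConjugate.conjExponent hp
  have hpow : ∀ x, u x ^ (p - 1) * u x = u x ^ p := fun x => by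
    rw [← Real.rpow_add_one' (hu x) (by linarith), sub_add_cancel]
  simp only [hpow] at h
  set A := ∫⁻ x, ENNReal.ofReal (u x ^ p) ∂μ
  set B := ∫⁻ x, ENNReal.ofReal (v x ^ p) ∂μ
  have hH := ENNReal.lintegral_mul_le_Lp_mul_Lq μ hpq.symm
    (f := fun x => ENNReal.ofReal (u x ^ (p - 1))) (g := fun x => ENNReal.ofReal (v x))
    (by fun_prop) (by fun_prop)
  have h1 : ∀ x, ENNReal.ofReal (u x ^ (p - 1)) ^ (p / (p - 1)) = ENNReal.ofReal (u x ^ p) := by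
    intro x
    rw [ENNReal.ofReal_rpow_of_nonneg (Real.rpow_nonneg (hu x) _) hpq.symm.nonneg,
      ← Real.rpow_mul (hu x), mul_div_cancel₀ _ (by linarith)]
  have h2 : ∀ x, ENNReal.ofReal (v x) ^ p = ENNReal.ofReal (v x ^ p) := fun x =>
    ENNReal.ofReal_rpow_of_nonneg (hv x) hp0.le
  simp only [Pi.mul_apply, h1, h2, ← ENNReal.ofReal_mul (Real.rpow_nonneg (hu _) _)] at hH
  have h3 : A ≤ A ^ (1 / (p / (p - 1))) * B ^ (1 / p) := h.trans hH
  rcases eq_or_ne A 0 with hA | hA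
  · rw [hA]
    exact zero_le
  -- As `0 < A < ∞`, the factor `A ^ (1 / q)`, with `q = p / (p - 1)`, cancels from `A ≤ A ^ (1 / q)
  -- * B ^ (1 / p)`.
  have h4 : A = A ^ (1 / (p / (p - 1))) * A ^ (1 / p) := by
    rw [← ENNReal.rpow_add _ _ hA hfin]
    have : 1 / (p / (p - 1)) + 1 / p = 1 := by
      simpa [one_div] using hpq.symm.inv_add_inv_eq_one
    rw [this, ENNReal.rpow_one]
  have h5 : A ^ (1 / p) ≤ B ^ (1 / p) := by
    rw [← ENNReal.mul_le_mul_iff_right (a := A ^ (1 / (p / (p - 1)))) ?_ ?_, ← h4]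
    · exact h3
    · exact (ENNReal.rpow_pos (pos_iff_ne_zero.mpr hA) hfin).ne'
    · exact ENNReal.rpow_ne_top_of_nonneg (one_div_nonneg.mpr hpq.symm.nonneg) hfin
  exact (ENNReal.rpow_le_rpow_iff (by positivity)).mp h5

/-- Hölder's inequality, in the form in which it compares two `Lᵖ` integrals for `p < 1`. -/
theorem lintegral_rpow_le_of_lt_one {α : Type*} [MeasurableSpace α] {μ : Measure α} {p : ℝ}
    (hp0 : 0 < p) (hp : p < 1) {u v : α → ℝ} (hum : Measurable u) (hvm : Measurable v)
    (hu : ∀ x, 0 ≤ u x) (hv : ∀ x, 0 < v x)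
    (h : ∫⁻ x, ENNReal.ofReal (v x ^ (p - 1) * u x) ∂μ ≤
      ∫⁻ x, ENNReal.ofReal (v x ^ (p - 1) * v x) ∂μ) :
    ∫⁻ x, ENNReal.ofReal (u x ^ p) ∂μ ≤ ∫⁻ x, ENNReal.ofReal (v x ^ p) ∂μ := by
  have hpq : (1 / p).HolderConjugate (1 / (1 - p)) := by
    rw [Real.holderConjugate_iff]
    refine ⟨by rw [lt_div_iff₀ hp0]; linarith, by simp⟩
  have hpow : ∀ x, v x ^ (p - 1) * v x = v x ^ p := fun x => by
    rw [← Real.rpow_add_one (hv x).ne', sub_add_cancel]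
  simp only [hpow] at h
  -- Hölder with exponents `1 / p` and `1 / (1 - p)` for `u^p = (v^(p-1) u)^p · v^(p(1-p))`.
  have hH := ENNReal.lintegral_mul_le_Lp_mul_Lq μ hpq
    (f := fun x => ENNReal.ofReal ((v x ^ (p - 1) * u x) ^ p))
    (g := fun x => ENNReal.ofReal (v x ^ (p * (1 - p)))) (by fun_prop) (by fun_prop)
  have h0 : ∀ x, 0 ≤ v x ^ (p - 1) * u x := fun x => mul_nonneg (Real.rpow_nonneg (hv x).le _) (hu x)
  have h1 : ∀ x, ENNReal.ofReal ((v x ^ (p - 1) * u x) ^ p) ^ (1 / p) =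
      ENNReal.ofReal (v x ^ (p - 1) * u x) := by
    intro x
    rw [ENNReal.ofReal_rpow_of_nonneg (Real.rpow_nonneg (h0 x) _) hpq.nonneg,
      ← Real.rpow_mul (h0 x), mul_one_div_cancel hp0.ne', Real.rpow_one]
  have h2 : ∀ x, ENNReal.ofReal (v x ^ (p * (1 - p))) ^ (1 / (1 - p)) =
      ENNReal.ofReal (v x ^ p) := by
    intro x
    rw [ENNReal.ofReal_rpow_of_nonneg (Real.rpow_nonneg (hv x).le _) hpq.symm.nonneg,
      ← Real.rpow_mul (hv x).le, mul_assoc, mul_one_div_cancel (by linarith), mul_one]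
  have h3 : ∀ x, ENNReal.ofReal ((v x ^ (p - 1) * u x) ^ p) * ENNReal.ofReal (v x ^ (p * (1 - p))) =
      ENNReal.ofReal (u x ^ p) := by
    intro x
    rw [← ENNReal.ofReal_mul (Real.rpow_nonneg (h0 x) _),
      Real.mul_rpow (Real.rpow_nonneg (hv x).le _) (hu x), ← Real.rpow_mul (hv x).le,
      mul_right_comm, ← Real.rpow_add (hv x)]
    have : (p - 1) * p + p * (1 - p) = 0 := by ring
    rw [this, Real.rpow_zero, one_mul]
  simp only [Pi.mul_apply, h1, h2, h3, one_div_one_div] at hH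
  set B := ∫⁻ x, ENNReal.ofReal (v x ^ p) ∂μ
  calc _ ≤ _ := hH
    _ ≤ B ^ p * B ^ (1 - p) := by gcongr
    _ = B := by
      rw [← ENNReal.rpow_add_of_nonneg _ _ hp0.le (by linarith), add_sub_cancel, ENNReal.rpow_one]

/-! ### Zeros of `ψ` when the exponent `p - 1` is negative -/

open Filter Topology in
/-- If a negative power (with the convention `0 ^ r = 0`) of a continuous non-negative function is
continuous, then the function vanishes either everywhere or nowhere. -/
theorem eq_zero_or_pos_of_continuous_rpow {X : Type*} [TopologicalSpace X] [PreconnectedSpace X]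
    {u : X → ℝ} (hu : Continuous u) (hu0 : ∀ x, 0 ≤ u x) {r : ℝ} (hr : r < 0)
    (hc : Continuous fun x => u x ^ r) : (∀ x, u x = 0) ∨ ∀ x, 0 < u x := by
  -- Near a zero both `u` and `u ^ r` are below `1`, but `0 < u < 1` forces `u ^ r > 1`; so `u`
  -- vanishes nearby.
  have hopen : IsOpen {x | u x = 0} := by
    rw [isOpen_iff_mem_nhds]
    intro x (hx : u x = 0)
    have h1 : ∀ᶠ y in 𝓝 x, u y ^ r < 1 := by
      refine hc.continuousAt.eventually_lt continuousAt_const ?_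
      simp [hx, Real.zero_rpow hr.ne]
    have h2 : ∀ᶠ y in 𝓝 x, u y < 1 :=
      hu.continuousAt.eventually_lt continuousAt_const (by simp [hx])
    filter_upwards [h1, h2] with y hy1 hy2
    by_contra hy
    have hpos : 0 < u y := lt_of_le_of_ne (hu0 y) (Ne.symm hy)
    exact absurd hy1 (not_lt.mpr (Real.one_lt_rpow_of_pos_of_lt_one_of_neg hpos hy2 hr).le)
  rcases isClopen_iff.mp ⟨isClosed_eq hu continuous_const, hopen⟩ with h | h
  · exact Or.inr fun x => lt_of_le_of_ne (hu0 x) fun h0 =>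
      (Set.eq_empty_iff_forall_notMem.mp h) x h0.symm
  · exact Or.inl fun x => (Set.eq_univ_iff_forall.mp h) x

/-- A continuous non-negative function whose Radon transform vanishes is zero. -/
theorem eq_zero_of_radonTransform_eq_zero {n : ℕ} (hn : 1 ≤ n) {φ : EuclideanSpace ℝ (Fin n) → ℝ}
    (hφc : Continuous φ) (hφ0 : ∀ x, 0 ≤ φ x) (h : ∀ t θ, radonTransform φ t θ = 0)
    (x : EuclideanSpace ℝ (Fin n)) : φ x = 0 := by
  have : Nontrivial (EuclideanSpace ℝ (Fin n)) := by
    have : Nonempty (Fin n) := ⟨⟨0, hn⟩⟩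
    infer_instance
  obtain ⟨v, hv⟩ := (NormedSpace.sphere_nonempty (x := (0 : EuclideanSpace ℝ (Fin n)))).mpr
    zero_le_one
  have hv1 : ‖v‖ = 1 := by simpa using hv
  have hc : Continuous fun y : (ℝ ∙ v)ᗮ =>
      ENNReal.ofReal (φ (⟪v, x⟫ • v + (y : EuclideanSpace ℝ (Fin n)))) :=
    ENNReal.continuous_ofReal.comp (by fun_prop)
  -- One direction `v` suffices: `x` lies on its hyperplane at height `⟪v, x⟫`, where a continuous
  -- non-negative function with zero integral vanishes.
  have hae := (lintegral_eq_zero_iff hc.measurable).mp (h ⟪v, x⟫ ⟨v, hv⟩)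
  have h0 := (hc.ae_eq_iff_eq volume continuous_zero).mp hae
  have hmem : x - ⟪v, x⟫ • v ∈ (ℝ ∙ v)ᗮ := by
    rw [Submodule.mem_orthogonal_singleton_iff_inner_right, inner_sub_right,
      real_inner_smul_right, real_inner_self_eq_norm_sq, hv1]
    ring
  have h1 := congrFun h0 ⟨_, hmem⟩
  simp only [add_sub_cancel, Pi.zero_apply, ENNReal.ofReal_eq_zero] at h1
  exact le_antisymm h1 (hφ0 x)

/-! ### The comparison theorem -/

theorem theoremt {n : ℕ} (hn : 1 ≤ n) {p : ℝ} (hp : 0 < p)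
    {φ ψ : EuclideanSpace ℝ (Fin n) → ℝ}
    (hφc : Continuous φ) (hψc : Continuous ψ)
    (hφ0 : ∀ x, 0 ≤ φ x) (hψ0 : ∀ x, 0 ≤ ψ x)
    (hφe : Function.Even φ) (hψe : Function.Even ψ)
    (hφ1 : MemLp φ 1) (hφp : MemLp φ (ENNReal.ofReal p))
    (hψ1 : MemLp ψ 1) (hψp : MemLp ψ (ENNReal.ofReal p))
    (hR : ∀ (t : ℝ) (θ : Metric.sphere (0 : EuclideanSpace ℝ (Fin n)) 1),
      radonTransform φ t θ ≤ radonTransform ψ t θ) :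
    (1 < p → IsIntersectionFunction (fun x => φ x ^ (p - 1)) →
      eLpNorm φ (ENNReal.ofReal p) ≤ eLpNorm ψ (ENNReal.ofReal p)) ∧
    (p < 1 → IsIntersectionFunction (fun x => ψ x ^ (p - 1)) →
      eLpNorm φ (ENNReal.ofReal p) ≤ eLpNorm ψ (ENNReal.ofReal p)) := by
  rw [eLpNorm_ofReal_eq_lintegral_ofReal_rpow hp hφ0,
    eLpNorm_ofReal_eq_lintegral_ofReal_rpow hp hψ0]
  refine ⟨fun hp1 hf => ENNReal.rpow_le_rpow ?_ (by positivity),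
    fun hp1 hf => ENNReal.rpow_le_rpow ?_ (by positivity)⟩
  · exact lintegral_rpow_le_of_one_lt hp1 hφc.measurable hψc.measurable hφ0 hψ0
      (lintegral_ofReal_rpow_ne_top hp hφ0 hφp) (hf.lintegral_mul_le hφc hψc hφ0 hψ0 hR)
  -- The convention `0 ^ (p - 1) = 0` allows `ψ = 0`; then the Radon transform of `φ` vanishes and
  -- so does `φ`.
  · rcases eq_zero_or_pos_of_continuous_rpow hψc hψ0 (by linarith) hf.continuous with h0 | hpos
    · have hφ : ∀ x, φ x = 0 := eq_zero_of_radonTransform_eq_zero hn hφc hφ0 fun t θ =>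
        le_antisymm ((hR t θ).trans (by simp [radonTransform, h0])) zero_le
      simp [hφ, h0]
    · exact lintegral_rpow_le_of_lt_one hp hp1 hφc.measurable hψc.measurable hφ0 hpos
        (hf.lintegral_mul_le hφc hψc hφ0 hψ0 hR)
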